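/- Let $G$ be a finite group. All characters are characters of nonzero finite-dimensional complex representations; $\operatorname{Irr}(G)$ denotes the set of irreducible characters of $G$, a character $\lambda$ is linear if $\lambda(1)=1$, $\lambda^G$ denotes the character of $G$ induced from a character $\lambda$ of a subgroup, and $\operatorname{Cons}(\chi)=\{\phi\in\operatorname{Irr}(G):\langle\phi,\chi\rangle>0\}$ is the set of irreducible constituents of a character $\chi$ of $G$. The group $G$ is called almost monomial if for any two distinct $\chi,\phi\in\operatorname{Irr}(G)$ there exist a subgroup $H\leqslant G$ and a linear character $\lambda$ of $H$ such that $\chi\in\operatorname{Cons}(\lambda^G)$ and $\phi\notin\operatorname{Cons}(\lambda^G)$. For a normal subgroup $N\unlhd G$, the group $G$ is called relative almost monomial with respect to $N$ if for any two distinct $\chi,\phi\in\operatorname{Irr}(G)$ there exist a subgroup $H$ with $N\subseteq H\leqslant G$ and $\psi\in\operatorname{Irr}(H)$ such that the restriction $\psi_N$ belongs to $\operatorname{Irr}(N)$, $\chi\in\operatorname{Cons}(\psi^G)$ and $\phi\notin\operatorname{Cons}(\psi^G)$. Theorem. Let $A\unlhd G$ be an abelian normal subgroup. If $G$ is almost monomial,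 then $G$ is relative almost monomial with respect to $A$. -/

import Mathlib

open scoped ComplexOrder ComplexConjugate

/-- `χ` is a character of `G`: the trace function of a nonzero finite-dimensional complex linear
representation of `G`. By choice of a basis, the space may be taken to be `ℂⁿ`. -/
def IsGroupCharacter {G : Type*} [Group G] (χ : G → ℂ) : Prop :=
  ∃ (n : ℕ) (ρ : Representation ℂ G (Fin n → ℂ)), n ≠ 0 ∧ ρ.character = χ

/-- `Irr(G)`: the set of characters of irreducible complex representations of `G`. -/
def irrChars (G : Type*) [Group G] : Set (G → ℂ) :=
  {χ | ∃ (n : ℕ) (ρ : Representation ℂ G (Fin n → ℂ)), ρ.IsIrreducible ∧ ρ.character = χ}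

/-- A linear character is a character of degree one. -/
def IsLinearCharacter {G : Type*} [Group G] (χ : G → ℂ) : Prop :=
  IsGroupCharacter χ ∧ χ 1 = 1

/-- The function induced on `G` by `θ : H → ℂ`:
`θ^G(g) = |H|⁻¹ ∑_{x ∈ G} θ⁰(x g x⁻¹)`, where `θ⁰` is `θ` on `H` and `0` outside `H`. -/
noncomputable def inducedChar {G : Type*} [Group G] [Fintype G] (H : Subgroup G) (θ : H → ℂ) :
    G → ℂ :=
  open Classical in
  fun g => (Nat.card H : ℂ)⁻¹ *
    ∑ x : G, if h : x * g * x⁻¹ ∈ H then θ ⟨x * g * x⁻¹, h⟩ else 0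

/-- The restriction to `N` of a function on `H`, for subgroups `N ≤ H`. -/
def restrictChar {G : Type*} [Group G] {N H : Subgroup G} (h : N ≤ H) (ψ : H → ℂ) : N → ℂ :=
  fun a => ψ (Subgroup.inclusion h a)

/-- The usual scalar product of complex functions on a finite group. -/
noncomputable def charInner {G : Type*} [Group G] [Fintype G] (φ χ : G → ℂ) : ℂ :=
  (Nat.card G : ℂ)⁻¹ * ∑ g : G, φ g * conj (χ g)

/-- `Cons(χ)`: the set of irreducible constituents of `χ`. -/
def constituents {G : Type*} [Group G] [Fintype G] (χ : G → ℂ) : Set (G → ℂ) :=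
  {φ | φ ∈ irrChars G ∧ 0 < charInner φ χ}

/-- `G` is almost monomial. -/
def IsAlmostMonomial (G : Type*) [Group G] [Fintype G] : Prop :=
  ∀ χ ∈ irrChars G, ∀ φ ∈ irrChars G, χ ≠ φ →
    ∃ (H : Subgroup G) (lam : H → ℂ), IsLinearCharacter lam ∧
      χ ∈ constituents (inducedChar H lam) ∧ φ ∉ constituents (inducedChar H lam)

/-- `G` is relative almost monomial with respect to its normal subgroup `N`. -/
def IsRelativeAlmostMonomial {G : Type*} [Group G] [Fintype G] (N : Subgroup G) [N.Normal] :
    Prop :=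
  ∀ χ ∈ irrChars G, ∀ φ ∈ irrChars G, χ ≠ φ →
    ∃ (H : Subgroup G) (hNH : N ≤ H) (ψ : H → ℂ), ψ ∈ irrChars H ∧
      restrictChar hNH ψ ∈ irrChars N ∧
      χ ∈ constituents (inducedChar H ψ) ∧ φ ∉ constituents (inducedChar H ψ)

/-!
For a linear character `f` of `H ≤ G`, Frobenius reciprocity says that the multiplicity of an
irreducible `χ` in `f^G` is the dimension of the space of vectors `v` in a module `V` affording `χ`
on which `H` acts through `f`, i.e. `h v = f(h) v`. So `χ ∈ Cons(f^G)` means that such an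
*`f`-eigenvector* `v ≠ 0` exists (`mem_constituents_inducedChar_iff`), and the theorem becomes a
statement about eigenvectors.

Suppose `λ` is a linear character of `H` such that `H` has a `λ`-eigenvector `v ≠ 0` in the module
of `χ`, but none in the module of `φ`. As `A` is abelian, some character `μ` of `A` gives a nonzero
component `w = e_μ v`, where `e_μ = |A|⁻¹ ∑ μ(a⁻¹) a`
(`Representation.exists_linearProj_apply_ne_zero`). The elements `h ∈ H` that fix `μ` under
conjugation form a subgroup `H_μ`, and they commute with `e_μ`; hence `A H_μ` scales `w`, through a
linear character `ψ` that extends `μ` and `λ|H_μ`. Thus `χ ∈ Cons(ψ^G)`, and `ψ_A = μ` is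
irreducible.

Conversely, let `u` be a `ψ`-eigenvector in the module of `φ`. Averaging, put
`u' = |H|⁻¹ ∑ λ(h⁻¹) h u`, a `λ`-eigenvector of `H`. The vector `h u` lies in the eigenspace of the
conjugate of `μ` by `h`, so `e_μ` kills it unless `h ∈ H_μ`; therefore
`e_μ u' = (|H_μ| / |H|) u`, and `u ≠ 0` would give `u' ≠ 0`
(`Representation.linearProj_apply_ne_zero`). So `φ ∉ Cons(ψ^G)`.
-/

/-! ### Linear characters as homomorphisms -/

/-- The one-dimensional representation in which `g` acts as multiplication by `f g`. -/
noncomputable def MonoidHom.lineRepresentation {G : Type*} [Group G] (f : G →* ℂ) :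
    Representation ℂ G (Fin 1 → ℂ) :=
  { toFun := fun g => f g • LinearMap.id
    map_one' := by simp; rfl
    map_mul' := fun g h => by ext; simp [mul_assoc, mul_left_comm] }

theorem MonoidHom.character_lineRepresentation {G : Type*} [Group G] (f : G →* ℂ) :
    f.lineRepresentation.character = f := by
  ext g
  simp [Representation.character, MonoidHom.lineRepresentation]

theorem MonoidHom.mem_irrChars {G : Type*} [Group G] (f : G →* ℂ) : (f : G → ℂ) ∈ irrChars G := by
  refine ⟨1, f.lineRepresentation, ?_, f.character_lineRepresentation⟩
  have hs : IsSimpleModule ℂ (Fin 1 → ℂ) := isSimpleModule_iff_finrank_eq_one.2 (by simp)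
  have h01 : (⊥ : Submodule ℂ (Fin 1 → ℂ)) ≠ ⊤ := bot_ne_top
  refine { exists_pair_ne := ⟨⊥, ⊤, fun h => h01 (congrArg Subrepresentation.toSubmodule h)⟩
           eq_bot_or_eq_top := fun W => ?_ }
  exact (eq_bot_or_eq_top W.toSubmodule).imp
    (fun h => Subrepresentation.toSubmodule_injective h)
    (fun h => Subrepresentation.toSubmodule_injective h)

theorem IsLinearCharacter.exists_monoidHom {G : Type*} [Group G] {χ : G → ℂ}
    (h : IsLinearCharacter χ) : ∃ f : G →* ℂ, (f : G → ℂ) = χ := by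
  obtain ⟨⟨n, ρ, -, rfl⟩, h1⟩ := h
  have hn : n = 1 := by simpa using h1
  subst hn
  have key (g : G) : ρ.character g = LinearMap.toMatrix' (ρ g) 0 0 := by
    simp [Representation.character, LinearMap.trace_eq_matrix_trace ℂ (Pi.basisFun ℂ (Fin 1)),
      Matrix.trace, LinearMap.toMatrix_eq_toMatrix']
  refine ⟨{ toFun := ρ.character, map_one' := h1, map_mul' := fun x y => ?_ }, rfl⟩
  rw [key, key, key, map_mul, LinearMap.toMatrix'_mul, Matrix.mul_apply, Fin.sum_univ_one]

theorem MonoidHom.conj_apply_eq {G : Type*} [Group G] [Finite G] (f : G →* ℂ) (g : G) :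
    conj (f g) = f g⁻¹ := by
  have hn : ‖f g‖ = 1 := by
    refine Complex.norm_eq_one_of_pow_eq_one (n := orderOf g) ?_ (orderOf_pos g).ne'
    rw [← map_pow, pow_orderOf_eq_one, map_one]
  rw [← Complex.inv_eq_conj hn]
  exact inv_eq_of_mul_eq_one_left (by rw [← map_mul, inv_mul_cancel, map_one])

/-! ### Eigenvectors and the averaging projection -/

namespace Representation

variable {G V : Type*} [Group G] [AddCommGroup V] [Module ℂ V]

/-- `v` is an `f`-eigenvector of `ρ`: every `g` multiplies `v` by `f g`. The vector `0` is
included. -/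
def IsLinearEigenvector (ρ : Representation ℂ G V) (f : G →* ℂ) (v : V) : Prop :=
  ∀ g, ρ g v = f g • v

/-- The projection `|G|⁻¹ ∑ f(g⁻¹) ρ(g)` onto the space of `f`-eigenvectors. -/
noncomputable def linearProj [Fintype G] (ρ : Representation ℂ G V) (f : G →* ℂ) : V →ₗ[ℂ] V :=
  (Nat.card G : ℂ)⁻¹ • ∑ g : G, f g⁻¹ • ρ g

variable [Fintype G] (ρ : Representation ℂ G V) (f : G →* ℂ)

theorem linearProj_apply (v : V) :
    ρ.linearProj f v = (Nat.card G : ℂ)⁻¹ • ∑ g : G, f g⁻¹ • ρ g v := by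
  simp [linearProj]

theorem isLinearEigenvector_linearProj (v : V) :
    ρ.IsLinearEigenvector f (ρ.linearProj f v) := by
  intro k
  rw [linearProj_apply, map_smul, smul_comm (f k), map_sum]
  congr 1
  rw [Finset.smul_sum, ← Equiv.sum_comp (Equiv.mulLeft k) fun g => f k • f g⁻¹ • ρ g v]
  refine Finset.sum_congr rfl fun g _ => ?_
  have hf : f k * f k⁻¹ = 1 := by rw [← map_mul, mul_inv_cancel, map_one]
  simp only [Equiv.coe_mulLeft, mul_inv_rev, map_mul, map_smul, smul_smul, Module.End.mul_apply]
  rw [mul_left_comm, hf, mul_one]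

variable {ρ f} in
theorem IsLinearEigenvector.linearProj_apply_eq {v : V} (hv : ρ.IsLinearEigenvector f v) :
    ρ.linearProj f v = v := by
  have h (g : G) : f g⁻¹ • ρ g v = v := by
    rw [hv g, smul_smul, ← map_mul, inv_mul_cancel, map_one, one_smul]
  rw [linearProj_apply, Finset.sum_congr rfl fun g _ => h g, Finset.sum_const, Finset.card_univ,
    ← Nat.cast_smul_eq_nsmul ℂ, smul_smul, Nat.card_eq_fintype_card,
    inv_mul_cancel₀ (by simp), one_smul]

/-- Eigenvectors for one linear character have no component for another one. -/
theorem IsLinearEigenvector.linearProj_apply_eq_zero {f f' : G →* ℂ} {v : V}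
    (hv : ρ.IsLinearEigenvector f v) (hne : f ≠ f') : ρ.linearProj f' v = 0 := by
  have h1 := ρ.isLinearEigenvector_linearProj f' v
  obtain ⟨k, hk⟩ := DFunLike.ne_iff.1 hne
  have h2 : ρ.linearProj f' v = ((Nat.card G : ℂ)⁻¹ * ∑ g : G, f' g⁻¹ * f g) • v := by
    rw [linearProj_apply, mul_smul, Finset.sum_smul]
    simp_rw [hv _, smul_smul]
  -- On the multiple `linearProj ρ f' v` of `v`, the element `k` acts both as `f' k` and as `f k`.
  have h3 : f' k • ρ.linearProj f' v = f k • ρ.linearProj f' v := by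
    rw [← h1 k, h2, map_smul, hv k, smul_comm]
  rw [← sub_eq_zero, ← sub_smul] at h3
  exact (smul_eq_zero.1 h3).resolve_left (sub_ne_zero.2 (Ne.symm hk))

theorem trace_linearProj :
    LinearMap.trace ℂ V (ρ.linearProj f) =
      (Nat.card G : ℂ)⁻¹ * ∑ g : G, ρ.character g * conj (f g) := by
  simp [linearProj, character, MonoidHom.conj_apply_eq, mul_comm]

/-- The trace of an idempotent is its rank, so it is positive exactly for a nonzero one. -/
theorem trace_linearProj_pos_iff [FiniteDimensional ℂ V] :
    0 < LinearMap.trace ℂ V (ρ.linearProj f) ↔ ∃ v ≠ 0, ρ.IsLinearEigenvector f v := by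
  have hidem : IsIdempotentElem (ρ.linearProj f) := LinearMap.ext fun v =>
    (ρ.isLinearEigenvector_linearProj f v).linearProj_apply_eq
  have hnat : LinearMap.trace ℂ V (ρ.linearProj f) = _ :=
    (LinearMap.IsIdempotentElem.isProj_range _ hidem).trace
  have hpos : 0 < LinearMap.trace ℂ V (ρ.linearProj f) ↔ ρ.linearProj f ≠ 0 := by
    rw [ne_eq, ← LinearMap.IsIdempotentElem.trace_eq_zero_iff hidem, hnat, Nat.cast_pos,
      Nat.cast_eq_zero, Nat.pos_iff_ne_zero]
  rw [hpos]
  constructor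
  · intro h
    obtain ⟨v, hv⟩ := DFunLike.ne_iff.1 h
    exact ⟨_, hv, ρ.isLinearEigenvector_linearProj f v⟩
  · rintro ⟨v, hv0, hv⟩ h
    exact hv0 (by rw [← hv.linearProj_apply_eq, h, LinearMap.zero_apply])

/-- For an abelian group the projections `linearProj ρ f`, over all linear characters `f`, add up
to the identity, so they cannot all kill a nonzero vector. -/
theorem exists_linearProj_apply_ne_zero [IsMulCommutative G] {v : V} (hv : v ≠ 0) :
    ∃ f : G →* ℂ, ρ.linearProj f v ≠ 0 := by
  classical
  let : CommGroup G := { ‹Group G› with mul_comm := mul_comm' }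
  by_contra! h
  let m (ψ : AddChar (Additive G) ℂ) : G →* ℂ :=
    { toFun := fun g => ψ (Additive.ofMul g)
      map_one' := ψ.map_zero_eq_one
      map_mul' := fun x y => ψ.map_add_eq_mul _ _ }
  have hsum : ∑ ψ, ρ.linearProj (m ψ) v = v := by
    have horth (g : G) : ∑ ψ, m ψ g⁻¹ • ρ g v = if g = 1 then (Nat.card G : ℂ) • v else 0 := by
      have h1 : ∑ ψ, m ψ g⁻¹ = if Additive.ofMul g⁻¹ = 0 then (Fintype.card (Additive G) : ℂ)
          else 0 := AddChar.sum_apply_eq_ite (Additive.ofMul g⁻¹)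
      have h2 : Additive.ofMul g⁻¹ = 0 ↔ g = 1 := by rw [ofMul_eq_zero, inv_eq_one]
      rw [← Finset.sum_smul, h1, if_congr h2 rfl rfl]
      split_ifs with hg
      · rw [hg, map_one, Module.End.one_apply, Nat.card_eq_fintype_card, Fintype.card_additive]
      · rw [zero_smul]
    simp_rw [linearProj_apply]
    rw [← Finset.smul_sum, Finset.sum_comm, Finset.sum_congr rfl fun g _ => horth g,
      Finset.sum_ite_eq' Finset.univ (1 : G) fun _ => (Nat.card G : ℂ) • v,
      if_pos (Finset.mem_univ _), smul_smul, inv_mul_cancel₀ (by simp), one_smul]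
  exact hv (by rw [← hsum]; exact Finset.sum_eq_zero fun ψ _ => h _)

omit [Fintype G] in
/-- A vector which every element of `G` scales is an eigenvector for some linear character. -/
theorem exists_isLinearEigenvector {v : V} (hv : v ≠ 0) (h : ∀ g, ∃ c : ℂ, ρ g v = c • v) :
    ∃ f : G →* ℂ, ρ.IsLinearEigenvector f v := by
  choose c hc using h
  refine ⟨{ toFun := c, map_one' := ?_, map_mul' := fun x y => ?_ }, hc⟩
  · exact smul_left_injective ℂ hv (by simp [← hc])
  · refine smul_left_injective ℂ hv ?_
    simp only
    rw [← hc, map_mul, Module.End.mul_apply, hc, map_smul, hc, smul_smul, mul_comm]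

end Representation

/-! ### Frobenius reciprocity for linear characters -/

section Frobenius

variable {G : Type*} [Group G] [Fintype G]

theorem charInner_inducedChar (χ : G → ℂ) (hχ : ∀ g x, χ (x * g * x⁻¹) = χ g) (H : Subgroup G)
    [Fintype H] (θ : H → ℂ) :
    charInner χ (inducedChar H θ) = (Nat.card H : ℂ)⁻¹ * ∑ h : H, χ h * conj (θ h) := by
  classical
  -- `F` extends `θ` by zero; replacing `g` by a conjugate makes all `x` contribute equally.
  set F : G → ℂ := fun g => if h : g ∈ H then θ ⟨g, h⟩ else 0 with hF
  have hconj (x : G) : ∑ g : G, χ g * conj (F (x * g * x⁻¹)) = ∑ g : G, χ g * conj (F g) := by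
    rw [← Equiv.sum_comp (MulAut.conj x).toEquiv fun g => χ g * conj (F g)]
    simp [hχ]
  have hind (g : G) : inducedChar H θ g = (Nat.card H : ℂ)⁻¹ * ∑ x : G, F (x * g * x⁻¹) := by
    simp only [inducedChar, hF]
  have hH : ∑ g : G, χ g * conj (F g) = ∑ h : H, χ h * conj (θ h) := by
    have hs : ∑ h : H, χ h * conj (θ h) = ∑ h : H, χ h * conj (F h) :=
      Finset.sum_congr rfl fun h _ => by simp [hF]
    rw [hs, ← Finset.sum_subtype (Finset.univ.filter (· ∈ H)) (by simp)
      fun g => χ g * conj (F g), Finset.sum_filter]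
    refine Finset.sum_congr rfl fun g _ => ?_
    split_ifs with hg
    · rfl
    · simp [hF, hg]
  calc charInner χ (inducedChar H θ)
      = (Nat.card G : ℂ)⁻¹ * ((Nat.card H : ℂ)⁻¹ *
          ∑ x : G, ∑ g : G, χ g * conj (F (x * g * x⁻¹))) := by
        rw [charInner, Finset.sum_comm, Finset.mul_sum Finset.univ _ (Nat.card H : ℂ)⁻¹]
        congr 1
        refine Finset.sum_congr rfl fun g _ => ?_
        rw [hind, map_mul, map_inv₀, Complex.conj_natCast, map_sum, ← Finset.mul_sum]
        ring
    _ = (Nat.card H : ℂ)⁻¹ * ∑ h : H, χ h * conj (θ h) := by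
        simp_rw [hconj, hH]
        have : (Fintype.card G : ℂ) ≠ 0 := by simp
        simp only [Finset.sum_const, Finset.card_univ, nsmul_eq_mul, Nat.card_eq_fintype_card]
        field_simp

theorem mem_constituents_inducedChar_iff {n : ℕ} (ρ : Representation ℂ G (Fin n → ℂ))
    (hρ : ρ.IsIrreducible) (H : Subgroup G) (f : H →* ℂ) :
    ρ.character ∈ constituents (inducedChar H f) ↔
      ∃ v ≠ 0, Representation.IsLinearEigenvector (ρ.comp H.subtype) f v := by
  classical
  have : ρ.character ∈ irrChars G := ⟨n, ρ, hρ, rfl⟩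
  rw [← Representation.trace_linearProj_pos_iff, Representation.trace_linearProj, constituents,
    Set.mem_ofPred_eq, and_iff_right this, charInner_inducedChar _ (fun g x => ρ.char_conj g x)]
  rfl

end Frobenius

/-! ### Eigenvectors of `A` and `H` -/

section Clifford

variable {G V : Type*} [Group G] [AddCommGroup V] [Module ℂ V] {A : Subgroup G} [A.Normal]

/-- The stabilizer in `G` of a linear character `μ` of a normal subgroup, under conjugation. -/
def MonoidHom.conjStabilizer (μ : A →* ℂ) : Subgroup G where
  carrier := {g | ∀ a, μ (MulAut.conjNormal g a) = μ a}
  one_mem' a := by simp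
  mul_mem' {x y} hx hy a := by rw [map_mul, MulAut.mul_apply, hx, hy]
  inv_mem' {x} hx a := by
    rw [← hx (MulAut.conjNormal x⁻¹ a), ← MulAut.mul_apply, ← map_mul, mul_inv_cancel, map_one,
      MulAut.one_apply]

namespace Representation

variable {ρ : Representation ℂ G V} {μ : A →* ℂ}

/-- An element `g` carries the `μ`-eigenspace of `A` to that of a conjugate of `μ`. -/
theorem IsLinearEigenvector.conj {v : V} (hv : IsLinearEigenvector (ρ.comp A.subtype) μ v)
    (g : G) : IsLinearEigenvector (ρ.comp A.subtype)
      (μ.comp (MulAut.conjNormal g⁻¹).toMonoidHom) (ρ g v) := by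
  intro a
  have h := hv (MulAut.conjNormal g⁻¹ a)
  have e : (a : G) * g = g * (MulAut.conjNormal g⁻¹ a : A) := by
    simp [mul_assoc]
  simp only [MonoidHom.comp_apply, Subgroup.subtype_apply] at h ⊢
  rw [← Module.End.mul_apply, ← map_mul, e, map_mul, Module.End.mul_apply, h, map_smul]
  rfl

variable [Fintype A]

theorem linearProj_comm_of_mem_conjStabilizer {g : G} (hg : g ∈ μ.conjStabilizer) (v : V) :
    ρ g (linearProj (ρ.comp A.subtype) μ v) = linearProj (ρ.comp A.subtype) μ (ρ g v) := by
  rw [linearProj_apply, linearProj_apply, map_smul, map_sum]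
  congr 1
  rw [← Equiv.sum_comp (MulAut.conjNormal g : MulAut A).toEquiv
    fun a => μ a⁻¹ • (ρ.comp A.subtype) a (ρ g v)]
  refine Finset.sum_congr rfl fun a _ => ?_
  have e : g * (a : G) = (MulAut.conjNormal g a : A) * g := by simp
  have h := hg a⁻¹
  simp only [MulEquiv.toEquiv_eq_coe, EquivLike.coe_coe, MonoidHom.comp_apply,
    Subgroup.subtype_apply, map_smul, ← map_inv, h]
  rw [← Module.End.mul_apply, ← map_mul, e, map_mul, Module.End.mul_apply]

/-- If `u ≠ 0` is a `μ`-eigenvector of `A` and a `lam`-eigenvector of the stabilizer of `μ` in `H`,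
then its average over `H` is nonzero, because its `μ`-component is a positive multiple of `u`. -/
theorem linearProj_apply_ne_zero {H : Subgroup G} [Fintype H] {lam : H →* ℂ} {u : V} (hu : u ≠ 0)
    (hA : IsLinearEigenvector (ρ.comp A.subtype) μ u)
    (hH : ∀ h : H, (h : G) ∈ μ.conjStabilizer → ρ h u = lam h • u) :
    linearProj (ρ.comp H.subtype) lam u ≠ 0 := by
  classical
  intro h0
  have hterm (h : H) : linearProj (ρ.comp A.subtype) μ (lam h⁻¹ • ρ h u) =
      if (h : G) ∈ μ.conjStabilizer then u else 0 := by
    split_ifs with hm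
    · rw [hH h hm, smul_smul, ← map_mul, inv_mul_cancel, map_one, one_smul, hA.linearProj_apply_eq]
    · rw [map_smul, (hA.conj (h : G)).linearProj_apply_eq_zero, smul_zero]
      intro he
      exact hm (inv_mem_iff.1 fun a => DFunLike.congr_fun he a)
  have h1 := congrArg (linearProj (ρ.comp A.subtype) μ) h0
  rw [linearProj_apply (ρ.comp H.subtype), map_smul, map_sum, map_zero] at h1
  have h2 := (smul_eq_zero.1 h1).resolve_left (by simp)
  simp only [MonoidHom.comp_apply, Subgroup.subtype_apply, hterm, ← Finset.sum_filter,
    Finset.sum_const] at h2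
  rw [← Nat.cast_smul_eq_nsmul ℂ, smul_eq_zero, Nat.cast_eq_zero, Finset.card_eq_zero] at h2
  refine (Finset.ne_empty_of_mem (a := (1 : H)) ?_) (h2.resolve_right hu)
  simp [one_mem]

end Representation

end Clifford

theorem theorem58 {G : Type*} [Group G] [Fintype G] (A : Subgroup G) [A.Normal]
    (hA : IsMulCommutative A) (hG : IsAlmostMonomial G) : IsRelativeAlmostMonomial A := by
  classical
  intro χ hχ φ hφ hne
  obtain ⟨H, lam, hlam, h1, h2⟩ := hG χ hχ φ hφ hne
  obtain ⟨lam, rfl⟩ := hlam.exists_monoidHom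
  obtain ⟨n, ρ, hρ, rfl⟩ := hχ
  obtain ⟨m, σ, hσ, rfl⟩ := hφ
  rw [mem_constituents_inducedChar_iff ρ hρ] at h1
  rw [mem_constituents_inducedChar_iff σ hσ] at h2
  obtain ⟨v, hv0, hv⟩ := h1
  obtain ⟨μ, hw0⟩ := Representation.exists_linearProj_apply_ne_zero (ρ.comp A.subtype) hv0
  set w := Representation.linearProj (ρ.comp A.subtype) μ v with hw
  have hwA (a : A) : ρ a w = μ a • w :=
    Representation.isLinearEigenvector_linearProj (ρ.comp A.subtype) μ v a
  have hwH (h : H) (hm : (h : G) ∈ μ.conjStabilizer) : ρ h w = lam h • w := by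
    have hh : ρ h v = lam h • v := hv h
    rw [hw, Representation.linearProj_comm_of_mem_conjStabilizer hm, hh, map_smul]
  -- As `A` is normal, this join is the product set `A H_μ`, whose elements all scale `w`.
  set T : Subgroup G := A ⊔ H ⊓ μ.conjStabilizer with hT
  have hAT : A ≤ T := le_sup_left
  have hHT : H ⊓ μ.conjStabilizer ≤ T := le_sup_right
  obtain ⟨ψ, hψ⟩ : ∃ ψ : T →* ℂ,
      Representation.IsLinearEigenvector (ρ.comp T.subtype) ψ w := by
    refine Representation.exists_isLinearEigenvector _ hw0 fun t => ?_
    obtain ⟨a, ha, h, hh, hah⟩ := Subgroup.mem_sup_of_normal_left.1 t.2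
    refine ⟨lam ⟨h, hh.1⟩ * μ ⟨a, ha⟩, ?_⟩
    have e1 : ρ h w = _ := hwH ⟨h, hh.1⟩ hh.2
    have e2 : ρ a w = _ := hwA ⟨a, ha⟩
    rw [MonoidHom.comp_apply, Subgroup.subtype_apply, ← hah, map_mul, Module.End.mul_apply, e1,
      map_smul, e2, smul_smul]
  have hψA (a : A) : ψ (Subgroup.inclusion hAT a) = μ a :=
    smul_left_injective ℂ hw0 ((hψ (Subgroup.inclusion hAT a)).symm.trans (hwA a))
  have hψH (h : H) (hm : (h : G) ∈ μ.conjStabilizer) : ψ ⟨h, hHT ⟨h.2, hm⟩⟩ = lam h :=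
    smul_left_injective ℂ hw0 ((hψ ⟨h, hHT ⟨h.2, hm⟩⟩).symm.trans (hwH h hm))
  refine ⟨T, hAT, ψ, ψ.mem_irrChars, (ψ.comp (Subgroup.inclusion hAT)).mem_irrChars,
    (mem_constituents_inducedChar_iff ρ hρ T ψ).2 ⟨w, hw0, hψ⟩, ?_⟩
  rw [mem_constituents_inducedChar_iff σ hσ]
  rintro ⟨u, hu0, hu⟩
  refine h2 ⟨_, Representation.linearProj_apply_ne_zero (μ := μ) hu0 (fun a => ?_)
    (fun h hm => ?_), Representation.isLinearEigenvector_linearProj (σ.comp H.subtype) lam u⟩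
  · rw [← hψA]
    exact hu (Subgroup.inclusion hAT a)
  · rw [← hψH h hm]
    exact hu ⟨h, hHT ⟨h.2, hm⟩⟩
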